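/- Let $\mathbb{K}$ be a field, let $G$ be a finite simple graph (not necessarily connected) with vertex set $\{x_1,\dots,x_n\}$, let $S=\mathbb{K}[x_1,\dots,x_n]$, and let $I(G)=(x_ix_j : x_ix_j\in E(G))\subseteq S$ be its edge ideal, with height $\mathrm{ht}(I(G))$. A matching of $G$ is a set of pairwise disjoint edges; a matching $M$ is induced if for all $e,e'\in M$ no edge of $G$ outside $M$ is contained in $e\cup e'$. Let $\mathrm{match}(G)$ and $\mathrm{ind\text{-}match}(G)$ be the largest cardinalities of a matching and of an induced matching of $G$, and call $G$ a Cameron–Walker graph if $\mathrm{match}(G)=\mathrm{ind\text{-}match}(G)$. For an integer $s\ge 0$ let $I(G)^{(s)}=\bigcap_{\mathfrak{p}\in\mathrm{Min}(I(G))}\mathrm{Ker}\big(S\to (S/I(G)^s)_{\mathfrak{p}}\big)$ be the $s$-th symbolic power of $I(G)$ (so $I(G)^{(0)}=S$), and let $I(G)^{\{s\}}$ be its squarefree part, i.e. the ideal generated by the squarefree monomials belonging to $I(G)^{(s)}$. For a homogeneous ideal $J$ of $S$ let $\mathrm{reg}(J)=\max\{j-i : \beta_{i,j}(J)\ne 0\}$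 be its Castelnuovo–Mumford regularity, where $\beta_{i,j}(J)$ are the graded Betti numbers, read off the minimal graded free resolution of $J$ over $S$. Suppose that $G$ is a Cameron–Walker graph and that $s$ is an integer with $\mathrm{ind\text{-}match}(G)\le s\le \mathrm{ht}(I(G))$. Then the ideal $I(G)^{\{s\}}$ has a minimal monomial generator of degree $s+\mathrm{ind\text{-}match}(G)$. In particular, $$\mathrm{reg}\big(I(G)^{\{s\}}\big)\ \ge\ s+\mathrm{ind\text{-}match}(G).$$ -/

import Mathlib

namespace SymbPow

open MvPolynomial

section Graphs

variable {V : Type*}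

/-- A matching of `G`: a finite set of pairwise disjoint edges. -/
def IsMatching (G : SimpleGraph V) (M : Finset (Sym2 V)) : Prop :=
  (∀ e ∈ M, e ∈ G.edgeSet) ∧
    ∀ e ∈ M, ∀ e' ∈ M, e ≠ e' → ∀ v : V, v ∈ e → v ∉ e'

/-- An induced matching of `G`: a matching `M` such that for all `e, e' ∈ M` there is no edge
of `G` outside `M` contained in `e ∪ e'`. -/
def IsInducedMatching (G : SimpleGraph V) (M : Finset (Sym2 V)) : Prop :=
  IsMatching G M ∧
    ∀ e ∈ M, ∀ e' ∈ M, ¬ ∃ f ∈ G.edgeSet, f ∉ M ∧ ∀ v ∈ f, v ∈ e ∨ v ∈ e'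

/-- The largest cardinality of a matching (`V` is finite in all uses, so this is a maximum). -/
noncomputable def matchingNumber (G : SimpleGraph V) : ℕ :=
  sSup {k | ∃ M : Finset (Sym2 V), IsMatching G M ∧ M.card = k}

/-- The largest cardinality of an induced matching. -/
noncomputable def inducedMatchingNumber (G : SimpleGraph V) : ℕ :=
  sSup {k | ∃ M : Finset (Sym2 V), IsInducedMatching G M ∧ M.card = k}

/-- `G` is a Cameron–Walker graph: its matching number equals its induced matching number. -/
def IsCameronWalker (G : SimpleGraph V) : Prop :=
  matchingNumber G = inducedMatchingNumber G

/-- The edge ideal of `G` in the polynomial ring over `K` whose variables are the vertices. -/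
noncomputable def edgeIdeal (K : Type*) [Field K] (G : SimpleGraph V) :
    Ideal (MvPolynomial V K) :=
  Ideal.span {f | ∃ v w : V, G.Adj v w ∧ f = X v * X w}

end Graphs

/-- The `s`-th symbolic power of `I`: the intersection, over the minimal primes `p` of `I`, of
the kernels of the natural maps from `R` to the localization of `R ⧸ I ^ s` at `p`. For `s = 0`
this is the whole ring. -/
noncomputable def symbolicPower {R : Type*} [CommRing R] (I : Ideal R) (s : ℕ) : Ideal R :=
  ⨅ p : I.minimalPrimes,
    haveI : (p : Ideal R).IsPrime := p.2.1.1
    LinearMap.ker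
      ((LocalizedModule.mkLinearMap (p : Ideal R).primeCompl (R ⧸ I ^ s)).comp
        (Submodule.mkQ (I ^ s)))

section Ideals

variable {V K : Type*} [Field K]

/-- The squarefree part of `I`: the ideal generated by the squarefree monomials in `I`. -/
noncomputable def squarefreePart (I : Ideal (MvPolynomial V K)) : Ideal (MvPolynomial V K) :=
  Ideal.span {f | f ∈ I ∧ ∃ m : V →₀ ℕ, (∀ v, m v ≤ 1) ∧ f = monomial m 1}

/-- The squarefree part of the `s`-th symbolic power of `I`. -/
noncomputable def squarefreeSymbolicPower (I : Ideal (MvPolynomial V K)) (s : ℕ) :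
    Ideal (MvPolynomial V K) :=
  squarefreePart (symbolicPower I s)

/-- The exponent vectors of the minimal monomial generators of a monomial ideal `J`: the
monomials of `J` that are minimal with respect to divisibility. -/
def minimalMonomialGenerators (J : Ideal (MvPolynomial V K)) : Set (V →₀ ℕ) :=
  {m | Minimal (fun m' : V →₀ ℕ => monomial m' (1 : K) ∈ J) m}

/-- A minimal graded free resolution
`⋯ → F₂ → F₁ → F₀ → J → 0` of a homogeneous ideal `J` of `S = K[V]`, by free modules
`Fᵢ = ⨁_b S(- deg i b)` of finite rank, given with homogeneous bases. -/
structure MinimalGradedFreeResolution (J : Ideal (MvPolynomial V K)) where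
  /-- the rank of `Fᵢ` -/
  rank : ℕ → ℕ
  /-- the degrees of the basis elements of `Fᵢ` -/
  deg : (i : ℕ) → Fin (rank i) → ℕ
  /-- the augmentation `F₀ → S`, with image `J` -/
  aug : (Fin (rank 0) → MvPolynomial V K) →ₗ[MvPolynomial V K] MvPolynomial V K
  /-- the differential `Fᵢ₊₁ → Fᵢ` -/
  d : (i : ℕ) → (Fin (rank (i + 1)) → MvPolynomial V K) →ₗ[MvPolynomial V K]
    (Fin (rank i) → MvPolynomial V K)
  /-- the augmentation preserves degrees -/
  aug_homogeneous : ∀ b, (aug (Pi.single b 1)).IsHomogeneous (deg 0 b)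
  /-- the differentials preserve degrees: every monomial in the `a`-th coordinate of the image
  of the `b`-th basis element has degree `deg (i + 1) b - deg i a` -/
  d_homogeneous : ∀ i b a, ∀ m ∈ (d i (Pi.single b 1) a).support,
    m.degree + deg i a = deg (i + 1) b
  /-- exactness at `J` -/
  range_aug : LinearMap.range aug = J
  /-- exactness at `F₀` -/
  exact_zero : LinearMap.range (d 0) = LinearMap.ker aug
  /-- exactness at `Fᵢ₊₁` -/
  exact_succ : ∀ i, LinearMap.range (d (i + 1)) = LinearMap.ker (d i)
  /-- minimality: the image of `Fᵢ₊₁` lies in `𝔪 Fᵢ`, where `𝔪` is the ideal generated by the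
  variables -/
  minimal : ∀ i w a, d i w a ∈ Ideal.span (Set.range (X : V → MvPolynomial V K))

open Classical in
/-- The graded Betti number `β_{i,j}(J)` of a homogeneous ideal: the number of basis elements of
degree `j` in position `i` of the (unique up to isomorphism) minimal graded free resolution. -/
noncomputable def gradedBetti (J : Ideal (MvPolynomial V K)) (i j : ℕ) : ℕ :=
  if h : Nonempty (MinimalGradedFreeResolution J) then
    Nat.card {b : Fin (h.some.rank i) // h.some.deg i b = j}
  else 0

/-- The Castelnuovo–Mumford regularity `max {j - i | β_{i,j}(J) ≠ 0}` of a homogeneous ideal, as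
a supremum in the extended reals (it is `⊥` for the zero ideal). -/
noncomputable def regularity (J : Ideal (MvPolynomial V K)) : EReal :=
  sSup {r : EReal | ∃ i j : ℕ, gradedBetti J i j ≠ 0 ∧ r = (((j : ℝ) - (i : ℝ) : ℝ) : EReal)}

end Ideals

end SymbPow

namespace SymbPow

/-! ### Matchings, vertex covers and the critical vertex set -/

section Combinatorics

variable {V : Type*} {G : SimpleGraph V}

/-! A monomial lies in `I(G)^(s)` exactly when its exponents sum to at least `s` over every vertex
cover (`monomial_mem_symbolicPower_edgeIdeal_iff`). Hence a squarefree generator of degree `s + ν`,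
with `ν` the induced matching number, amounts to a set `A` of `s + ν` vertices that every cover
meets at least `s` times, while no `A \ {v}` has this property.

Let `M` be an induced matching of size `ν`. The graph being Cameron–Walker, `M` is also a maximum
matching, so the vertices off `M` are independent, and the two ends of an edge of `M` cannot have
distinct neighbours off `M`. If both ends have neighbours off `M`, these are therefore one vertex,
the apex of a triangle. One suitable end of each edge of `M`, together with the set `Y` of all
apexes, covers `G`; hence `s ≤ ht I(G) ≤ ν + |Y|`, and `s - ν` apexes can be added to the `2ν`
vertices of `M` to form `A`. This set is partitioned into at most `ν` cliques (edges or triangles),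
so an independent set meets it in at most `ν` vertices and a cover in at least `s`. Given `v ∈ A`,
one end other than `v` of each edge of `M` gives an independent set of size `ν`, because `M` is
induced; its complement is a cover meeting `A \ {v}` in `s - 1` vertices.

The regularity bound follows because a minimal monomial generator forces a basis element of its
degree in `F₀`. As Betti numbers are read off a chosen resolution, the existence of one is also
proved. -/

theorem bddAbove_matching_card [Finite V] (P : Finset (Sym2 V) → Prop) :
    BddAbove {k | ∃ M : Finset (Sym2 V), P M ∧ M.card = k} := by
  have := Fintype.ofFinite (Sym2 V)
  refine ⟨Fintype.card (Sym2 V), ?_⟩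
  rintro _ ⟨M, -, rfl⟩
  exact Finset.card_le_univ M

theorem IsMatching.card_le_matchingNumber [Finite V] {M : Finset (Sym2 V)}
    (hM : IsMatching G M) : M.card ≤ matchingNumber G :=
  le_csSup (bddAbove_matching_card _) ⟨M, hM, rfl⟩

theorem exists_isInducedMatching_card_eq [Finite V] (G : SimpleGraph V) :
    ∃ M, IsInducedMatching G M ∧ M.card = inducedMatchingNumber G := by
  have : IsInducedMatching G ∅ := by simp [IsInducedMatching, IsMatching]
  exact Nat.sSup_mem (s := {k | ∃ M, IsInducedMatching G M ∧ M.card = k}) ⟨0, ∅, this, rfl⟩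
    (bddAbove_matching_card _)

theorem IsMatching.eq_of_mem {M : Finset (Sym2 V)} (hM : IsMatching G M) {e e' : Sym2 V}
    (he : e ∈ M) (he' : e' ∈ M) {v : V} (hv : v ∈ e) (hv' : v ∈ e') : e = e' := by
  by_contra h
  exact hM.2 e he e' he' h v hv hv'

theorem IsInducedMatching.mk_mem {M : Finset (Sym2 V)} (hM : IsInducedMatching G M)
    {e e' : Sym2 V} (he : e ∈ M) (he' : e' ∈ M) {a b : V} (ha : a ∈ e) (hb : b ∈ e')
    (h : G.Adj a b) : s(a, b) ∈ M := by
  by_contra hab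
  refine hM.2 e he e' he' ⟨s(a, b), h, hab, fun v hv => ?_⟩
  rcases Sym2.mem_iff.1 hv with rfl | rfl
  exacts [Or.inl ha, Or.inr hb]

theorem IsInducedMatching.eq_of_adj {M : Finset (Sym2 V)} (hM : IsInducedMatching G M)
    {e e' : Sym2 V} (he : e ∈ M) (he' : e' ∈ M) {a b : V} (ha : a ∈ e) (hb : b ∈ e')
    (h : G.Adj a b) : e = e' := by
  have hab := hM.mk_mem he he' ha hb h
  exact (hM.1.eq_of_mem he hab ha (Sym2.mem_mk_left a b)).trans
    (hM.1.eq_of_mem hab he' (Sym2.mem_mk_right a b) hb)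

/-- Two vertices outside a maximum matching are not adjacent. -/
theorem IsMatching.not_adj_of_card_eq [Finite V] {M : Finset (Sym2 V)} (hM : IsMatching G M)
    (hcard : M.card = matchingNumber G) {w w' : V} (hw : ∀ e ∈ M, w ∉ e)
    (hw' : ∀ e ∈ M, w' ∉ e) : ¬ G.Adj w w' := by
  classical
  intro h
  have hmem : s(w, w') ∉ M := fun h' => hw _ h' (Sym2.mem_mk_left w w')
  have : IsMatching G (insert s(w, w') M) := by
    refine ⟨fun e he => ?_, fun e he e' he' hne v hv hv' => ?_⟩
    · rcases Finset.mem_insert.1 he with rfl | he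
      exacts [h, hM.1 e he]
    · have aux : ∀ e ∈ M, v ∈ e → v ∉ s(w, w') := by
        intro f hf hvf hv'
        rcases Sym2.mem_iff.1 hv' with rfl | rfl
        exacts [hw f hf hvf, hw' f hf hvf]
      rcases Finset.mem_insert.1 he with rfl | he <;> rcases Finset.mem_insert.1 he' with rfl | he'
      exacts [hne rfl, aux e' he' hv' hv, aux e he hv hv', hM.2 e he e' he' hne v hv hv']
  have := this.card_le_matchingNumber
  rw [Finset.card_insert_of_notMem hmem] at this
  omega

/-- A maximum matching has no augmenting path of length three. -/
theorem IsMatching.eq_of_adj_adj_of_card_eq [Finite V] {M : Finset (Sym2 V)}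
    (hM : IsMatching G M) (hcard : M.card = matchingNumber G) {a b w w' : V}
    (hab : s(a, b) ∈ M) (hw : ∀ e ∈ M, w ∉ e) (hw' : ∀ e ∈ M, w' ∉ e)
    (hwa : G.Adj w a) (hwb : G.Adj w' b) : w = w' := by
  classical
  by_contra hne
  have hadj : G.Adj a b := hM.1 _ hab
  have haw' : a ≠ w' := fun h => hw' _ hab (h ▸ Sym2.mem_mk_left a b)
  have hbw : b ≠ w := fun h => hw _ hab (h ▸ Sym2.mem_mk_right a b)
  have hout : ∀ e ∈ M, e ≠ s(a, b) → a ∉ e ∧ b ∉ e := fun e he hne =>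
    ⟨fun h => hM.2 e he _ hab hne a h (Sym2.mem_mk_left a b),
      fun h => hM.2 e he _ hab hne b h (Sym2.mem_mk_right a b)⟩
  have h1 : s(w, a) ∉ M := fun h => hw _ h (Sym2.mem_mk_left w a)
  have h2 : s(w', b) ∉ M := fun h => hw' _ h (Sym2.mem_mk_left w' b)
  have h12 : s(w, a) ≠ s(w', b) := by
    intro h
    rcases Sym2.eq_iff.1 h with ⟨h, -⟩ | ⟨h, -⟩
    exacts [hne h, hbw h.symm]
  have hmatch : IsMatching G (insert s(w, a) (insert s(w', b) (M.erase s(a, b)))) := by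
    refine ⟨fun e he => ?_, fun e he e' he' hne' v hv hv' => ?_⟩
    · simp only [Finset.mem_insert, Finset.mem_erase] at he
      rcases he with rfl | rfl | he
      exacts [hwa, hwb, hM.1 e he.2]
    · have aux : ∀ e ∈ M, e ≠ s(a, b) → v ∈ e → v ≠ w ∧ v ≠ a ∧ v ≠ w' ∧ v ≠ b := by
        intro f hf hne hvf
        refine ⟨?_, ?_, ?_, ?_⟩ <;> rintro rfl
        exacts [hw f hf hvf, (hout f hf hne).1 hvf, hw' f hf hvf, (hout f hf hne).2 hvf]
      have hab_ne := hadj.ne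
      have hdisj := hM.2 e
      simp only [Finset.mem_insert, Finset.mem_erase] at he he'
      rcases he with rfl | rfl | ⟨h3, h4⟩ <;> rcases he' with rfl | rfl | ⟨h3', h4'⟩ <;>
        (try simp only [Sym2.mem_iff] at hv) <;> (try simp only [Sym2.mem_iff] at hv') <;> grind
  have := hmatch.card_le_matchingNumber
  rw [Finset.card_insert_of_notMem (by simp [h12, h1]), Finset.card_insert_of_notMem (by simp [h2]),
    Finset.card_erase_of_mem hab] at this
  have := Finset.card_pos.2 ⟨_, hab⟩
  omega

/-- In a Cameron–Walker graph, every `s` between the induced matching number `ν` and the vertex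
cover number is the vertex cover number of an induced subgraph on `s + ν` vertices that is
critical: removing any vertex lowers the vertex cover number. -/
theorem IsCameronWalker.exists_critical_finset [Finite V] (hG : IsCameronWalker G) [DecidableEq V]
    {s : ℕ} (hs : inducedMatchingNumber G ≤ s)
    (hcov : ∀ C : Finset V, G.IsVertexCover C → s ≤ C.card) :
    ∃ A : Finset V, A.card = s + inducedMatchingNumber G ∧
      (∀ C : Finset V, G.IsVertexCover C → s ≤ (A ∩ C).card) ∧
      ∀ v ∈ A, ∃ C : Finset V, G.IsVertexCover C ∧ (A.erase v ∩ C).card < s := by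
  classical
  have := Fintype.ofFinite V
  obtain ⟨M, hM, hMν⟩ := exists_isInducedMatching_card_eq G
  have hmax : M.card = matchingNumber G := hMν.trans hG.symm
  set ν := inducedMatchingNumber G
  set W : Finset V := M.biUnion Sym2.toFinset with hW
  have memW : ∀ {v}, v ∈ W ↔ ∃ e ∈ M, v ∈ e := by simp [hW]
  have notMemW : ∀ {v}, v ∉ W ↔ ∀ e ∈ M, v ∉ e := by simp [hW]
  have cardW : W.card = 2 * ν := by
    rw [hW, Finset.card_biUnion, Finset.sum_congr rfl fun e he =>
      Sym2.card_toFinset_of_not_isDiag e (G.not_isDiag_of_mem_edgeSet (hM.1.1 e he))]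
    · simp [hMν, mul_comm]
    · intro e he e' he' hne
      rw [Function.onFun, Finset.disjoint_left]
      simpa using hM.1.2 e he e' he' hne
  have mkmem : ∀ {e a b}, e ∈ M → a ∈ e → b ∈ e → a ≠ b → s(a, b) ∈ M := by
    intro e a b he ha hb hab
    rwa [← (Sym2.mem_and_mem_iff hab).1 ⟨ha, hb⟩]
  -- The apexes: vertices off the matching that span a triangle with some edge of `M`.
  let Y : Finset V := {y | y ∉ W ∧ ∃ e ∈ M, ∀ a ∈ e, G.Adj y a}
  have hsY : s ≤ Y.card + ν := by
    -- The chosen end `f e` has a neighbour off the matching whenever some end of `e` does;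
    -- otherwise the choice is arbitrary.
    have : ∀ e : Sym2 V, ∃ c ∈ e, (∃ a ∈ e, ∃ z ∉ W, G.Adj z a) → ∃ z ∉ W, G.Adj z c := by
      intro e
      by_cases h : ∃ a ∈ e, ∃ z ∉ W, G.Adj z a
      · obtain ⟨a, ha, h'⟩ := h
        exact ⟨a, ha, fun _ => h'⟩
      · induction e with | _ a b => exact ⟨a, Sym2.mem_mk_left a b, fun h' => absurd h' h⟩
    choose f hf hf' using this
    have key : ∀ a b, G.Adj a b → a ∈ W → b ∉ W → a ∈ Y ∪ M.image f ∨ b ∈ Y ∪ M.image f := by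
      intro a b hab ha hb
      obtain ⟨e, he, hae⟩ := memW.1 ha
      obtain ⟨z, hz, hzc⟩ := hf' e ⟨a, hae, b, hb, hab.symm⟩
      by_cases hac : f e = a
      · left
        exact Finset.mem_union_right _ (Finset.mem_image.2 ⟨e, he, hac⟩)
      · right
        -- Both ends `a` and `f e` now have neighbours off `M`. With no augmenting path these
        -- coincide, so `b` is an apex.
        have hmem := mkmem he hae (hf e) (Ne.symm hac)
        obtain rfl := hM.1.eq_of_adj_adj_of_card_eq hmax hmem (notMemW.1 hb) (notMemW.1 hz)
          hab.symm hzc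
        refine Finset.mem_union_left _ (Finset.mem_filter.2 ⟨Finset.mem_univ _, hb, _, hmem, ?_⟩)
        intro v hv
        rcases Sym2.mem_iff.1 hv with rfl | rfl
        exacts [hab.symm, hzc]
    refine (hcov (Y ∪ M.image f) ?_).trans ((Finset.card_union_le _ _).trans ?_)
    · intro a b hab
      simp only [Finset.mem_coe]
      by_cases ha : a ∈ W <;> by_cases hb : b ∈ W
      · obtain ⟨e, he, hae⟩ := memW.1 ha
        obtain ⟨e', he', hbe⟩ := memW.1 hb
        have hmem := hM.mk_mem he he' hae hbe hab
        have hfm : f s(a, b) ∈ Y ∪ M.image f :=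
          Finset.mem_union_right _ (Finset.mem_image_of_mem f hmem)
        rcases Sym2.mem_iff.1 (hf s(a, b)) with h | h
        · exact Or.inl (h ▸ hfm)
        · exact Or.inr (h ▸ hfm)
      · exact key a b hab ha hb
      · exact (key b a hab.symm hb ha).symm
      · exact absurd hab (hM.1.not_adj_of_card_eq hmax (notMemW.1 ha) (notMemW.1 hb))
    · have := Finset.card_image_le (s := M) (f := f)
      omega
  obtain ⟨Z, hZY, hZ⟩ := Finset.exists_subset_card_eq (s := Y) (n := s - ν) (by omega)
  have hZW : ∀ v ∈ Z, v ∉ W := fun v hv => (Finset.mem_filter.1 (hZY hv)).2.1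
  have cardA : (W ∪ Z).card = s + ν := by
    rw [Finset.card_union_of_disjoint (Finset.disjoint_right.2 hZW), cardW, hZ]
    omega
  refine ⟨W ∪ Z, cardA, fun C hC => ?_, fun v hv => ?_⟩
  · have hex : ∀ v ∈ (W ∪ Z) \ C, ∃ e ∈ M, v ∈ e ∨ (v ∉ W ∧ ∀ a ∈ e, G.Adj v a) := by
      intro v hv
      rcases Finset.mem_union.1 (Finset.mem_sdiff.1 hv).1 with h | h
      · obtain ⟨e, he, hve⟩ := memW.1 h
        exact ⟨e, he, Or.inl hve⟩
      · obtain ⟨h1, e, he, h2⟩ := (Finset.mem_filter.1 (hZY h)).2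
        exact ⟨e, he, Or.inr ⟨h1, h2⟩⟩
    have hle : ((W ∪ Z) \ C).card ≤ M.card := by
      rcases ((W ∪ Z) \ C).eq_empty_or_nonempty with h0 | ⟨x, -⟩
      · simp [h0]
      have : Nonempty (Sym2 V) := ⟨s(x, x)⟩
      choose! h hhM hh using hex
      refine Finset.card_le_card_of_injOn h hhM fun v hv v' hv' hvv' => ?_
      by_contra hne
      have hvC := (Finset.mem_sdiff.1 hv).2
      have hvC' := (Finset.mem_sdiff.1 hv').2
      have hnadj : ¬ G.Adj v v' := fun hadj => (hC hadj).elim hvC hvC'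
      have h1 := hh v hv
      have h2 := hh v' hv'
      have heM := hhM v hv
      rw [← hvv'] at h2
      generalize h v = e at h1 h2 heM
      rcases h1 with h1 | ⟨h1, h1'⟩ <;> rcases h2 with h2 | ⟨h2, h2'⟩
      · exact hnadj (hM.1.1 _ (mkmem heM h1 h2 hne))
      · exact hnadj (h2' v h1).symm
      · exact hnadj (h1' v' h2)
      -- Two distinct apexes of one edge would give an augmenting path.
      · induction e with | _ a b =>
          exact hne (hM.1.eq_of_adj_adj_of_card_eq hmax heM (notMemW.1 h1) (notMemW.1 h2)
            (h1' a (Sym2.mem_mk_left a b)) (h2' b (Sym2.mem_mk_right a b)))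
    have := Finset.card_sdiff_add_card_inter (W ∪ Z) C
    omega
  · have hex : ∀ e ∈ M, ∃ c ∈ e, c ≠ v := by
      intro e he
      have hne := G.not_isDiag_of_mem_edgeSet (hM.1.1 e he)
      induction e with | _ a b =>
        by_cases h : a = v
        · exact ⟨b, Sym2.mem_mk_right a b, fun h' => hne (by simp [h, h'])⟩
        · exact ⟨a, Sym2.mem_mk_left a b, h⟩
    have : Nonempty V := ⟨v⟩
    choose! t ht htv using hex
    have htinj : Set.InjOn t M := fun e he e' he' hee' =>
      hM.1.eq_of_mem he he' (ht e he) (hee' ▸ ht e' he')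
    have hTA : M.image t ⊆ W ∪ Z := by
      intro c hc
      obtain ⟨e, he, rfl⟩ := Finset.mem_image.1 hc
      exact Finset.mem_union_left _ (memW.2 ⟨e, he, ht e he⟩)
    have hcardT : (M.image t).card = ν := by rw [Finset.card_image_of_injOn htinj, hMν]
    -- The transversal avoiding `v` is independent because `M` is induced, so its complement is a
    -- cover.
    refine ⟨(M.image t)ᶜ, fun a b hab => ?_, ?_⟩
    · by_contra! hcon
      simp only [Finset.coe_compl, Set.mem_compl_iff, not_not, Finset.mem_coe,
        Finset.mem_image] at hcon
      obtain ⟨⟨e, he, rfl⟩, ⟨e', he', rfl⟩⟩ := hcon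
      obtain rfl := hM.eq_of_adj he he' (ht e he) (ht e' he') hab
      exact G.loopless.irrefl _ hab
    · have hvT : v ∉ M.image t := by
        intro h
        obtain ⟨e, he, h⟩ := Finset.mem_image.1 h
        exact htv e he h
      rw [← Finset.sdiff_eq_inter_compl, Finset.erase_sdiff_comm,
        Finset.card_erase_of_mem (Finset.mem_sdiff.2 ⟨hv, hvT⟩), Finset.card_sdiff_of_subset hTA]
      have : 0 < (W ∪ Z).card := Finset.card_pos.2 ⟨v, hv⟩
      have : 0 < ((W ∪ Z) \ M.image t).card :=
        Finset.card_pos.2 ⟨v, Finset.mem_sdiff.2 ⟨hv, hvT⟩⟩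
      rw [Finset.card_sdiff_of_subset hTA] at this
      omega

end Combinatorics

open MvPolynomial

/-! ### Monomials in symbolic powers of edge ideals -/

section SymbolicPowers

variable {V K : Type*} [Field K]

theorem mem_symbolicPower_iff {R : Type*} [CommRing R] {I : Ideal R} {s : ℕ} {f : R} :
    f ∈ symbolicPower I s ↔ ∀ p ∈ I.minimalPrimes, ∃ t ∉ p, t * f ∈ I ^ s := by
  simp only [symbolicPower, Submodule.mem_iInf, Subtype.forall]
  refine forall₂_congr fun p hp => ?_
  have : p.IsPrime := hp.1.1
  rw [LinearMap.ker_comp, Submodule.mem_comap, LocalizedModule.mem_ker_mkLinearMap_iff]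
  refine exists_congr fun t => and_congr Iff.rfl ?_
  rw [← map_smul, Submodule.mkQ_apply, Submodule.Quotient.mk_eq_zero, smul_eq_mul]

theorem span_X_isPrime (C : Set V) :
    (Ideal.span (X '' C : Set (MvPolynomial V K))).IsPrime := by
  classical
  let φ : MvPolynomial V K →ₐ[K] MvPolynomial V K := aeval fun v => if v ∈ C then 0 else X v
  have hφ : Ideal.span (X '' C : Set (MvPolynomial V K)) = RingHom.ker φ := by
    refine le_antisymm (Ideal.span_le.2 ?_) fun f hf => ?_
    · rintro _ ⟨v, hv, rfl⟩
      simp [φ, hv]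
    -- Killing the variables in `C` changes nothing modulo the ideal they generate, so an element of
    -- the kernel lies in that ideal.
    · have key : (Ideal.Quotient.mkₐ K (Ideal.span (X '' C : Set (MvPolynomial V K)))).comp φ =
          Ideal.Quotient.mkₐ K _ := by
        refine algHom_ext fun v => ?_
        by_cases hv : v ∈ C
        · simpa [φ, hv] using (Ideal.Quotient.eq_zero_iff_mem.2
            (Ideal.subset_span (Set.mem_image_of_mem X hv))).symm
        · simp [φ, hv]
      have := DFunLike.congr_fun key f
      rw [AlgHom.comp_apply, RingHom.mem_ker.1 hf, map_zero] at this
      exact Ideal.Quotient.eq_zero_iff_mem.1 this.symm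
  rw [hφ]
  exact RingHom.ker_isPrime _

theorem edgeIdeal_le_span_X {G : SimpleGraph V} {C : Set V} (hC : G.IsVertexCover C) :
    edgeIdeal K G ≤ Ideal.span (X '' C) := by
  refine Ideal.span_le.2 ?_
  rintro _ ⟨v, w, h, rfl⟩
  rcases hC h with h | h
  · exact Ideal.mul_mem_right _ _ (Ideal.subset_span ⟨v, h, rfl⟩)
  · exact Ideal.mul_mem_left _ _ (Ideal.subset_span ⟨w, h, rfl⟩)

theorem isVertexCover_of_edgeIdeal_le {G : SimpleGraph V} {p : Ideal (MvPolynomial V K)}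
    (hp : p.IsPrime) (h : edgeIdeal K G ≤ p) : G.IsVertexCover {v | X v ∈ p} :=
  fun v w hvw => hp.mem_or_mem (h (Ideal.subset_span ⟨v, w, hvw, rfl⟩))

theorem eq_span_X_of_mem_minimalPrimes {G : SimpleGraph V} {p : Ideal (MvPolynomial V K)}
    (hp : p ∈ (edgeIdeal K G).minimalPrimes) {C : Set V} (hC : G.IsVertexCover C)
    (hCp : ∀ v ∈ C, X v ∈ p) : p = Ideal.span (X '' C) := by
  have hle : Ideal.span (X '' C) ≤ p := by
    refine Ideal.span_le.2 ?_
    rintro _ ⟨v, hv, rfl⟩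
    exact hCp v hv
  exact le_antisymm (hp.2 ⟨span_X_isPrime C, edgeIdeal_le_span_X hC⟩ hle) hle

theorem X_mem_span_X_iff {C : Set V} {v : V} :
    (X v : MvPolynomial V K) ∈ Ideal.span (X '' C) ↔ v ∈ C := by
  classical
  rw [mem_ideal_span_X_image]
  simp [support_X, Finsupp.single_apply]

/-- Krull's height theorem, applied to the prime generated by the variables of the cover. -/
theorem height_edgeIdeal_le_card [Finite V] {G : SimpleGraph V} {C : Finset V}
    (hC : G.IsVertexCover C) : (edgeIdeal K G).height ≤ C.card := by
  classical
  have hprime := span_X_isPrime (K := K) (C : Set V)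
  refine (Ideal.height_mono (edgeIdeal_le_span_X hC)).trans ?_
  have : Ideal.span (X '' (C : Set V)) ∈
      (Ideal.span ((C.image X : Finset (MvPolynomial V K)) :
        Set (MvPolynomial V K))).minimalPrimes := by
    rw [Finset.coe_image, Ideal.minimalPrimes_eq_subsingleton_self]
    rfl
  refine (Ideal.height_le_card_of_mem_minimalPrimes_span_finset this).trans ?_
  exact_mod_cast Finset.card_image_le

/-- If all neighbours of `v` were also in the cover defined by `p`, removing `v` would leave a
cover, and its variables would generate a smaller prime over the edge ideal. -/
theorem exists_adj_notMem_of_mem_minimalPrimes {G : SimpleGraph V}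
    {p : Ideal (MvPolynomial V K)} (hp : p ∈ (edgeIdeal K G).minimalPrimes) {v : V}
    (hv : X v ∈ p) : ∃ w, G.Adj v w ∧ X w ∉ p := by
  by_contra! hcon
  have hcov := isVertexCover_of_edgeIdeal_le hp.1.1 hp.1.2
  have hC : G.IsVertexCover ({v | X v ∈ p} \ {v}) := by
    intro a b hab
    by_cases ha : a = v
    · subst ha
      exact Or.inr ⟨hcon b hab, hab.ne'⟩
    by_cases hb : b = v
    · subst hb
      exact Or.inl ⟨hcon a hab.symm, ha⟩
    rcases hcov hab with h | h
    exacts [Or.inl ⟨h, ha⟩, Or.inr ⟨h, hb⟩]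
  rw [eq_span_X_of_mem_minimalPrimes hp hC fun _ h => h.1, X_mem_span_X_iff] at hv
  exact hv.2 rfl

/-- Pair each factor `X v` with `v` in the cover of `p` with a neighbour's variable outside `p`. The
product of these partners is a multiplier outside `p` that creates at least `s` edge factors. -/
theorem monomial_mem_symbolicPower_edgeIdeal [Finite V] {G : SimpleGraph V} {s : ℕ} {m : V →₀ ℕ}
    (h : ∀ C : Finset V, G.IsVertexCover C → s ≤ ∑ v ∈ C, m v) :
    monomial m (1 : K) ∈ symbolicPower (edgeIdeal K G) s := by
  classical
  have := Fintype.ofFinite V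
  rw [mem_symbolicPower_iff]
  intro p hp
  have hprime : p.IsPrime := hp.1.1
  let C : Finset V := {v | X v ∈ p}
  have hs : s ≤ ∑ v ∈ C, m v := h C (by
    simpa [C] using isVertexCover_of_edgeIdeal_le hp.1.1 hp.1.2)
  have hex : ∀ v ∈ C, ∃ w, G.Adj v w ∧ X w ∉ p := fun v hv =>
    exists_adj_notMem_of_mem_minimalPrimes hp (Finset.mem_filter.1 hv).2
  choose! w hw hwp using hex
  refine ⟨∏ v ∈ C, X (w v) ^ m v, fun hmem => ?_, ?_⟩
  · obtain ⟨v, hv, hmem⟩ := hprime.prod_mem_iff.1 hmem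
    exact hwp v hv (hprime.mem_of_pow_mem _ hmem)
  · have hmon : monomial m (1 : K) = (∏ v ∈ C, X v ^ m v) * ∏ v ∈ Cᶜ, X v ^ m v := by
      rw [Finset.prod_mul_prod_compl, monomial_eq, Finsupp.prod_fintype _ _ (by simp)]
      simp
    rw [hmon, ← mul_assoc, ← Finset.prod_mul_distrib]
    refine Ideal.mul_mem_right _ _ (Ideal.pow_le_pow_right hs ?_)
    rw [← Finset.prod_pow_eq_pow_sum]
    refine Ideal.prod_mem_prod fun v hv => ?_
    rw [← mul_pow]
    refine Ideal.pow_mem_pow (Ideal.subset_span ?_) _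
    exact ⟨w v, v, (hw v hv).symm, rfl⟩

/-- The powers of the prime ideal generated by the variables in `C` are primary; for monomials.
The proof uses the ring map `X v ↦ T * X v` for `v ∈ C`, `X v ↦ X v` otherwise. -/
theorem le_sum_of_mul_monomial_mem_span_X_pow [Finite V] {C : Finset V} {s : ℕ} {m : V →₀ ℕ}
    {t : MvPolynomial V K} (ht : t ∉ Ideal.span (X '' (C : Set V)))
    (h : t * monomial m 1 ∈ Ideal.span (X '' (C : Set V)) ^ s) : s ≤ ∑ v ∈ C, m v := by
  classical
  have := Fintype.ofFinite V
  by_contra! hlt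
  let φ : MvPolynomial V K →ₐ[K] Polynomial (MvPolynomial V K) :=
    aeval fun v => if v ∈ C then Polynomial.X * Polynomial.C (X v) else Polynomial.C (X v)
  have hφ : ∀ f ∈ Ideal.span (X '' (C : Set V)) ^ s, Polynomial.X ^ s ∣ φ f := by
    have hle : Ideal.span (X '' (C : Set V)) ≤ (Ideal.span {Polynomial.X}).comap φ := by
      refine Ideal.span_le.2 ?_
      rintro _ ⟨v, hv, rfl⟩
      simp [φ, Finset.mem_coe.1 hv, Ideal.mem_span_singleton]
    intro f hf
    have := Ideal.le_comap_pow φ s (Ideal.pow_right_mono hle s hf)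
    rwa [Ideal.mem_comap, Ideal.span_singleton_pow, Ideal.mem_span_singleton] at this
  have hm : φ (monomial m 1) = Polynomial.X ^ (∑ v ∈ C, m v) * Polynomial.C (monomial m 1) := by
    rw [monomial_eq, Finsupp.prod_fintype _ _ (by simp)]
    simp only [map_one, one_mul, map_prod, map_pow, φ, aeval_X]
    rw [← Finset.prod_mul_prod_compl C, ← Finset.prod_mul_prod_compl C, ← mul_assoc,
      ← Finset.prod_pow_eq_pow_sum, ← Finset.prod_mul_distrib]
    congr 1
    · exact Finset.prod_congr rfl fun v hv => by rw [if_pos hv, mul_pow]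
    · exact Finset.prod_congr rfl fun v hv => by simp [Finset.mem_compl.1 hv]
  -- The monomial contributes exactly `T ^ ∑ m v`, which is less than `T ^ s`, so a factor `T` must
  -- divide `φ t`. Putting `T = 0` is the identity modulo the ideal, which forces `t` into it.
  have hdvd := (pow_dvd_pow _ (Nat.succ_le_of_lt hlt)).trans (hφ _ h)
  rw [map_mul, hm, mul_left_comm, pow_succ] at hdvd
  have hdvd := (mul_dvd_mul_iff_left (pow_ne_zero _ Polynomial.X_ne_zero)).1 hdvd
  rw [Polynomial.X_dvd_iff, Polynomial.mul_coeff_zero, Polynomial.coeff_C_zero, mul_eq_zero,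
    or_iff_left (by simp)] at hdvd
  apply ht
  have key : (Ideal.Quotient.mkₐ K (Ideal.span (X '' (C : Set V)))).comp
      (((Polynomial.aeval (0 : MvPolynomial V K)).restrictScalars K).comp φ) =
      Ideal.Quotient.mkₐ K _ := by
    refine algHom_ext fun v => ?_
    by_cases hv : v ∈ C
    · simpa [φ, hv] using (Ideal.Quotient.eq_zero_iff_mem.2
        (Ideal.subset_span (Set.mem_image_of_mem X (Finset.mem_coe.2 hv)))).symm
    · simp [φ, hv]
  have hzero : Polynomial.aeval (0 : MvPolynomial V K) (φ t) = 0 := by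
    rw [Polynomial.aeval_def, Polynomial.eval₂_at_zero, hdvd, map_zero]
  have := DFunLike.congr_fun key t
  rw [AlgHom.comp_apply, AlgHom.comp_apply, AlgHom.restrictScalars_apply, hzero, map_zero] at this
  exact Ideal.Quotient.eq_zero_iff_mem.1 this.symm

theorem monomial_mem_symbolicPower_edgeIdeal_iff [Finite V] {G : SimpleGraph V} {s : ℕ}
    {m : V →₀ ℕ} : monomial m (1 : K) ∈ symbolicPower (edgeIdeal K G) s ↔
      ∀ C : Finset V, G.IsVertexCover C → s ≤ ∑ v ∈ C, m v := by
  classical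
  have := Fintype.ofFinite V
  refine ⟨fun h C hC => ?_, monomial_mem_symbolicPower_edgeIdeal⟩
  have hprime := span_X_isPrime (K := K) (C : Set V)
  -- The cover `C` need not be minimal: a minimal prime below its ideal is generated by the
  -- variables of a cover `D ⊆ C`, and the sum over `D` already suffices.
  obtain ⟨p, hp, hpC⟩ := Ideal.exists_minimalPrimes_le (edgeIdeal_le_span_X (K := K) hC)
  obtain ⟨t, ht, hmem⟩ := mem_symbolicPower_iff.1 h p hp
  let D : Finset V := {v | X v ∈ p}
  have hpD : p = Ideal.span (X '' (D : Set V)) := by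
    refine eq_span_X_of_mem_minimalPrimes hp ?_ (by simp [D])
    simpa [D] using isVertexCover_of_edgeIdeal_le hp.1.1 hp.1.2
  have hDC : D ⊆ C := fun v hv =>
    X_mem_span_X_iff.1 (hpC (Finset.mem_filter.1 hv).2)
  have hmem := Ideal.pow_right_mono hp.1.2 s hmem
  rw [hpD] at hmem ht
  exact (le_sum_of_mul_monomial_mem_span_X_pow ht hmem).trans (Finset.sum_le_sum_of_subset hDC)

end SymbolicPowers

/-! ### Existence of minimal graded free resolutions -/

section Resolutions

variable {V K : Type*} [Field K]

/-- The homogeneous component of degree `k` of an element of the graded free module with basis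
elements of degrees `deg`. -/
noncomputable def gradedComponent {n : ℕ} (deg : Fin n → ℕ) (k : ℕ) :
    (Fin n → MvPolynomial V K) →ₗ[K] (Fin n → MvPolynomial V K) :=
  -- Without the guard, truncated subtraction would return the constant term when `k < deg a`.
  LinearMap.pi fun a => (if deg a ≤ k then homogeneousComponent (k - deg a) else 0).comp
    (LinearMap.proj a)

theorem coeff_gradedComponent {n : ℕ} (deg : Fin n → ℕ) (k : ℕ) (w : Fin n → MvPolynomial V K)
    (a : Fin n) (m : V →₀ ℕ) : coeff m (gradedComponent deg k w a) =
      if m.degree + deg a = k then coeff m (w a) else 0 := by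
  classical
  simp only [gradedComponent, LinearMap.pi_apply, LinearMap.comp_apply, LinearMap.proj_apply]
  split_ifs with h1 h2 h2
  · rw [coeff_homogeneousComponent, if_pos (by omega)]
  · rw [coeff_homogeneousComponent, if_neg (by omega)]
  · omega
  · simp

/-- Homogeneous elements of degree `k` of a graded free module. -/
def IsGradedHomogeneous {n : ℕ} (deg : Fin n → ℕ) (k : ℕ) (w : Fin n → MvPolynomial V K) : Prop :=
  ∀ a, ∀ m ∈ (w a).support, m.degree + deg a = k

theorem isGradedHomogeneous_gradedComponent {n : ℕ} (deg : Fin n → ℕ) (k : ℕ)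
    (w : Fin n → MvPolynomial V K) : IsGradedHomogeneous deg k (gradedComponent deg k w) := by
  intro a m hm
  rw [mem_support_iff, coeff_gradedComponent] at hm
  by_contra h
  exact hm (if_neg h)

theorem IsGradedHomogeneous.gradedComponent_monomial_smul {n : ℕ} {deg : Fin n → ℕ} {j : ℕ}
    {w : Fin n → MvPolynomial V K} (hw : IsGradedHomogeneous deg j w) (k : ℕ) (m : V →₀ ℕ)
    (c : K) : gradedComponent deg k (monomial m c • w) =
      if m.degree + j = k then monomial m c • w else 0 := by
  classical
  ext a m'
  rw [coeff_gradedComponent]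
  by_cases h : coeff m' (monomial m c * w a) = 0
  · have : coeff m' ((if m.degree + j = k then monomial m c • w else 0 :
        Fin n → MvPolynomial V K) a) = 0 := by
      split_ifs
      · exact h
      · rfl
    rw [this, Pi.smul_apply, smul_eq_mul, h, ite_self]
  · have hdeg : m'.degree + deg a = m.degree + j := by
      rw [coeff_monomial_mul'] at h
      split_ifs at h with hle
      · have := hw a (m' - m) (mem_support_iff.2 (right_ne_zero_of_mul h))
        rw [← this, ← add_assoc, ← map_add, add_tsub_cancel_of_le hle]
      · exact absurd rfl h
    rw [hdeg]
    split_ifs <;> rfl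

theorem IsGradedHomogeneous.single {n : ℕ} (deg : Fin n → ℕ) (b : Fin n) :
    IsGradedHomogeneous deg (deg b) (Pi.single b (1 : MvPolynomial V K)) := by
  classical
  intro a m hm
  by_cases h : a = b
  · subst h
    rw [Pi.single_eq_same, mem_support_iff, coeff_one] at hm
    split_ifs at hm with h0
    · simp [← h0]
    · exact absurd rfl hm
  · simp [Pi.single_eq_of_ne h] at hm

theorem map_gradedComponent {n r : ℕ} {deg' : Fin n → ℕ} {deg : Fin r → ℕ}
    {φ : (Fin n → MvPolynomial V K) →ₗ[MvPolynomial V K] (Fin r → MvPolynomial V K)}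
    (hφ : ∀ b, IsGradedHomogeneous deg (deg' b) (φ (Pi.single b 1))) (k : ℕ)
    (w : Fin n → MvPolynomial V K) :
    φ (gradedComponent deg' k w) = gradedComponent deg k (φ w) := by
  have hw : w = ∑ b, w b • Pi.single b (1 : MvPolynomial V K) := by
    simpa using pi_eq_sum_univ' w
  rw [hw]
  simp only [map_sum]
  refine Finset.sum_congr rfl fun b _ => ?_
  induction w b using MvPolynomial.induction_on' with
  | monomial m c =>
    rw [(IsGradedHomogeneous.single deg' b).gradedComponent_monomial_smul, map_smul,
      (hφ b).gradedComponent_monomial_smul]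
    split_ifs
    · rw [map_smul]
    · rw [map_zero]
  | add p q hp hq => simp only [add_smul, map_add, hp, hq]

/-- Graded submodules of a graded free module. -/
def IsGradedSubmodule {n : ℕ} (deg : Fin n → ℕ)
    (N : Submodule (MvPolynomial V K) (Fin n → MvPolynomial V K)) : Prop :=
  ∀ k, ∀ w ∈ N, gradedComponent deg k w ∈ N

theorem isGradedSubmodule_ker {n r : ℕ} {deg' : Fin n → ℕ} {deg : Fin r → ℕ}
    {φ : (Fin n → MvPolynomial V K) →ₗ[MvPolynomial V K] (Fin r → MvPolynomial V K)}
    (hφ : ∀ b, IsGradedHomogeneous deg (deg' b) (φ (Pi.single b 1))) :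
    IsGradedSubmodule deg' (LinearMap.ker φ) := by
  intro k w hw
  rw [LinearMap.mem_ker, map_gradedComponent hφ, LinearMap.mem_ker.1 hw, map_zero]

theorem exists_sum_gradedComponent_eq {n : ℕ} (deg : Fin n → ℕ) (w : Fin n → MvPolynomial V K) :
    ∃ s : Finset ℕ, ∑ k ∈ s, gradedComponent deg k w = w := by
  classical
  refine ⟨Finset.univ.biUnion fun a => (w a).support.image fun m => m.degree + deg a, ?_⟩
  ext a m
  rw [Finset.sum_apply, coeff_sum]
  simp only [coeff_gradedComponent]
  rw [Finset.sum_ite_eq]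
  split_ifs with h
  · rfl
  · by_contra h'
    exact h (Finset.mem_biUnion.2 ⟨a, Finset.mem_univ a,
      Finset.mem_image_of_mem _ (mem_support_iff.2 (Ne.symm h'))⟩)

theorem IsGradedSubmodule.span_homogeneous {n : ℕ} {deg : Fin n → ℕ}
    {N : Submodule (MvPolynomial V K) (Fin n → MvPolynomial V K)} (hN : IsGradedSubmodule deg N) :
    Submodule.span _ {w | w ∈ N ∧ ∃ k, IsGradedHomogeneous deg k w} = N := by
  refine le_antisymm (Submodule.span_le.2 fun w hw => hw.1) fun w hw => ?_
  obtain ⟨s, hs⟩ := exists_sum_gradedComponent_eq deg w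
  rw [← hs]
  exact Submodule.sum_mem _ fun k _ => Submodule.subset_span
    ⟨hN k w hw, k, isGradedHomogeneous_gradedComponent deg k w⟩

/-- A finite family of homogeneous generators of a graded submodule. -/
def IsHomogeneousGenerators {r : ℕ} (deg : Fin r → ℕ)
    (N : Submodule (MvPolynomial V K) (Fin r → MvPolynomial V K)) {n : ℕ} (deg' : Fin n → ℕ)
    (g : Fin n → Fin r → MvPolynomial V K) : Prop :=
  (∀ b, IsGradedHomogeneous deg (deg' b) (g b)) ∧ Submodule.span _ (Set.range g) = N

theorem IsGradedSubmodule.exists_isHomogeneousGenerators [Finite V] {r : ℕ} {deg : Fin r → ℕ}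
    {N : Submodule (MvPolynomial V K) (Fin r → MvPolynomial V K)} (hN : IsGradedSubmodule deg N) :
    ∃ (n : ℕ) (deg' : Fin n → ℕ) (g : Fin n → Fin r → MvPolynomial V K),
      IsHomogeneousGenerators deg N deg' g := by
  have hfg : N.FG := IsNoetherian.noetherian N
  rw [← hN.span_homogeneous, Submodule.fg_span_iff_fg_span_finset_subset] at hfg
  obtain ⟨S, hS, hspan⟩ := hfg
  have hhom : ∀ b : Fin S.card, ∃ k, IsGradedHomogeneous deg k (S.equivFin.symm b).1 :=
    fun b => (hS (S.equivFin.symm b).2).2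
  choose deg' hdeg' using hhom
  refine ⟨S.card, deg', fun b => (S.equivFin.symm b).1, hdeg', ?_⟩
  rw [← hN.span_homogeneous, hspan]
  congr 1
  ext w
  exact ⟨fun ⟨b, hb⟩ => hb ▸ (S.equivFin.symm b).2,
    fun hw => ⟨S.equivFin ⟨w, hw⟩, by simp⟩⟩

theorem mem_span_range_X_iff {f : MvPolynomial V K} :
    f ∈ Ideal.span (Set.range (X : V → MvPolynomial V K)) ↔ coeff 0 f = 0 := by
  rw [← Set.image_univ, mem_ideal_span_X_image]
  constructor
  · intro h
    by_contra h0
    obtain ⟨i, -, hi⟩ := h 0 (mem_support_iff.2 h0)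
    exact hi rfl
  · intro h m hm
    by_contra! hcon
    obtain rfl : m = 0 := Finsupp.ext fun i => hcon i (Set.mem_univ i)
    exact mem_support_iff.1 hm h

/-- The map from a graded free module onto a graded submodule given by a family of homogeneous
generators of minimal length has its kernel in the span of the variables. -/
theorem IsGradedSubmodule.exists_minimal_cover [Finite V] {r : ℕ} {deg : Fin r → ℕ}
    {N : Submodule (MvPolynomial V K) (Fin r → MvPolynomial V K)} (hN : IsGradedSubmodule deg N) :
    ∃ (n : ℕ) (deg' : Fin n → ℕ)
      (φ : (Fin n → MvPolynomial V K) →ₗ[MvPolynomial V K] (Fin r → MvPolynomial V K)),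
      (∀ b, IsGradedHomogeneous deg (deg' b) (φ (Pi.single b 1))) ∧ LinearMap.range φ = N ∧
      ∀ w ∈ LinearMap.ker φ, ∀ a, w a ∈ Ideal.span (Set.range (X : V → MvPolynomial V K)) := by
  classical
  have hex := hN.exists_isHomogeneousGenerators
  obtain ⟨deg', g, hg⟩ := Nat.find_spec hex
  have hmin : ∀ n < Nat.find hex, ¬ _ := fun n hn => Nat.find_min hex hn
  generalize Nat.find hex = n at deg' g hg hmin
  let φ := Fintype.linearCombination (MvPolynomial V K) g
  have hφs : ∀ b, φ (Pi.single b 1) = g b := fun b => by simp [φ]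
  have hφ : ∀ b, IsGradedHomogeneous deg (deg' b) (φ (Pi.single b 1)) := fun b => by
    rw [hφs]
    exact hg.1 b
  refine ⟨n, deg', φ, hφ, (Fintype.range_linearCombination _ g).trans hg.2, fun w hw a => ?_⟩
  rw [mem_span_range_X_iff]
  by_contra hc
  -- The component in degree `deg' a` is still a relation, and its `a`-th coordinate is a nonzero
  -- constant. Generator `a` is thus a combination of the others, against minimal length.
  set w' := gradedComponent deg' (deg' a) w with hw'
  have hwker : φ w' = 0 := isGradedSubmodule_ker hφ _ w hw
  have hwa : w' a = C (coeff 0 (w a)) := by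
    ext m
    rw [hw', coeff_gradedComponent, coeff_C]
    by_cases hm : m = 0
    · simp [hm]
    · have : m.degree ≠ 0 := by rwa [Ne, Finsupp.degree_eq_zero_iff]
      rw [if_neg (by omega), if_neg (Ne.symm hm)]
  obtain ⟨n, rfl⟩ : ∃ k, n = k + 1 := ⟨n - 1, by have := a.2; omega⟩
  refine hmin n (Nat.lt_succ_self n) ⟨deg' ∘ a.succAbove, g ∘ a.succAbove,
    fun b => hg.1 _, ?_⟩
  refine le_antisymm (hg.2 ▸ Submodule.span_mono (Set.range_comp_subset_range _ _)) ?_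
  rw [← hg.2, Submodule.span_le]
  have hsub : ∀ b, g (a.succAbove b) ∈
      Submodule.span (MvPolynomial V K) (Set.range (g ∘ a.succAbove)) :=
    fun b => Submodule.subset_span ⟨b, rfl⟩
  rintro _ ⟨b, rfl⟩
  obtain rfl | ⟨b, rfl⟩ := a.eq_self_or_eq_succAbove b
  swap
  · exact hsub b
  have hsum : w' b • g b = -∑ i, w' (b.succAbove i) • g (b.succAbove i) := by
    rw [eq_neg_iff_add_eq_zero, ← Fin.sum_univ_succAbove (fun i => w' i • g i) b]
    simpa [φ, Fintype.linearCombination_apply] using hwker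
  have : g b = (C (coeff 0 (w b))⁻¹ : MvPolynomial V K) • (w' b • g b) := by
    rw [smul_smul, hwa, ← C_mul, inv_mul_cancel₀ hc, C_1, one_smul]
  rw [SetLike.mem_coe, this, hsum]
  exact Submodule.smul_mem _ _ (neg_mem (Submodule.sum_mem _ fun i _ =>
    Submodule.smul_mem _ _ (hsub i)))

/-- A graded free module of finite rank together with a graded submodule. -/
structure SyzygyStage (V K : Type*) [Field K] where
  rank : ℕ
  deg : Fin rank → ℕ
  syz : Submodule (MvPolynomial V K) (Fin rank → MvPolynomial V K)
  graded : IsGradedSubmodule deg syz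

theorem SyzygyStage.exists_next [Finite V] (T : SyzygyStage V K) :
    ∃ (T' : SyzygyStage V K)
      (φ : (Fin T'.rank → MvPolynomial V K) →ₗ[MvPolynomial V K] (Fin T.rank → MvPolynomial V K)),
      (∀ b, IsGradedHomogeneous T.deg (T'.deg b) (φ (Pi.single b 1))) ∧
      LinearMap.range φ = T.syz ∧ LinearMap.ker φ = T'.syz ∧
      ∀ w ∈ T'.syz, ∀ a, w a ∈ Ideal.span (Set.range (X : V → MvPolynomial V K)) := by
  obtain ⟨n, deg', φ, h1, h2, h3⟩ := T.graded.exists_minimal_cover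
  exact ⟨⟨n, deg', LinearMap.ker φ, isGradedSubmodule_ker h1⟩, φ, h1, h2, rfl, h3⟩

/-- Homogeneous ideals have minimal graded free resolutions. -/
theorem nonempty_minimalGradedFreeResolution [Finite V] {J : Ideal (MvPolynomial V K)}
    (hJ : ∀ k, ∀ f ∈ J, homogeneousComponent k f ∈ J) :
    Nonempty (MinimalGradedFreeResolution J) := by
  choose next φ hhom hrange hker hmin using SyzygyStage.exists_next (V := V) (K := K)
  -- Stage zero is `S` in degree 0 with `J` as its submodule, so `Fᵢ` of the resolution is stage `i
  -- + 1`.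
  let T₀ : SyzygyStage V K :=
    { rank := 1
      deg := fun _ => 0
      syz := Submodule.comap
        (LinearMap.proj (R := MvPolynomial V K) (φ := fun _ : Fin 1 => MvPolynomial V K) 0) J
      graded := fun k w hw => by
        simpa [gradedComponent] using hJ k _ hw }
  let T : ℕ → SyzygyStage V K := fun i => Nat.rec T₀ (fun _ => next) i
  refine ⟨{
    rank := fun i => (T (i + 1)).rank
    deg := fun i => (T (i + 1)).deg
    aug := (LinearMap.proj (R := MvPolynomial V K) (φ := fun _ : Fin 1 => MvPolynomial V K) 0).comp
      (φ T₀)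
    d := fun i => φ (T (i + 1))
    aug_homogeneous := fun b => ?_
    d_homogeneous := fun i b a => hhom (T (i + 1)) b a
    range_aug := ?_
    exact_zero := ?_
    exact_succ := fun i => (hrange (T (i + 2))).trans (hker (T (i + 1))).symm
    minimal := fun i w a => hmin (T i) _ (hrange (T (i + 1)) ▸ LinearMap.mem_range_self _ w) a }⟩
  · intro m hm
    have := hhom T₀ b 0 m (mem_support_iff.2 hm)
    refine Eq.trans ?_ this
    rw [Finsupp.degree_eq_weight_one]
    rfl
  · rw [LinearMap.range_comp, hrange]
    exact Submodule.map_comap_eq_of_surjective (LinearMap.proj_surjective (0 : Fin 1)) _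
  · refine (hrange (T 1)).trans ((hker T₀).symm.trans ?_)
    have : Function.Injective (LinearMap.proj 0 :
        (Fin 1 → MvPolynomial V K) →ₗ[MvPolynomial V K] MvPolynomial V K) := fun x y h => by
      ext1 i
      rw [Subsingleton.elim i 0]
      exact h
    exact (LinearMap.ker_comp_of_ker_eq_bot _ (LinearMap.ker_eq_bot.2 this)).symm

end Resolutions

/-! ### Minimal generators of the squarefree part and regularity -/

section SquarefreePart

variable {V K : Type*} [Field K]

theorem squarefreePart_le (I : Ideal (MvPolynomial V K)) : squarefreePart I ≤ I :=
  Ideal.span_le.2 fun _ hf => hf.1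

theorem monomial_mem_squarefreePart_iff {I : Ideal (MvPolynomial V K)} {m : V →₀ ℕ}
    (hm : ∀ v, m v ≤ 1) : monomial m 1 ∈ squarefreePart I ↔ monomial m 1 ∈ I :=
  ⟨fun h => squarefreePart_le I h, fun h => Ideal.subset_span ⟨h, m, hm, rfl⟩⟩

/-- An ideal generated by monomials contains the monomials of its elements. -/
def IsMonomialIdeal (J : Ideal (MvPolynomial V K)) : Prop :=
  ∀ f, f ∈ J ↔ ∀ m ∈ f.support, monomial m 1 ∈ J

theorem isMonomialIdeal_squarefreePart (I : Ideal (MvPolynomial V K)) :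
    IsMonomialIdeal (squarefreePart I) := by
  classical
  have hspan : squarefreePart I = Ideal.span ((fun m => monomial m (1 : K)) ''
      {m | (∀ v, m v ≤ 1) ∧ monomial m 1 ∈ I}) := by
    refine congrArg Ideal.span (Set.ext fun f => ⟨?_, ?_⟩)
    · rintro ⟨h, m, hm, rfl⟩
      exact ⟨m, ⟨hm, h⟩, rfl⟩
    · rintro ⟨m, ⟨hm, h⟩, rfl⟩
      exact ⟨h, m, hm, rfl⟩
  intro f
  simp [hspan, mem_ideal_span_monomial_image, support_monomial]

theorem IsMonomialIdeal.homogeneousComponent_mem {J : Ideal (MvPolynomial V K)}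
    (hJ : IsMonomialIdeal J) (k : ℕ) {f : MvPolynomial V K} (hf : f ∈ J) :
    homogeneousComponent k f ∈ J := by
  rw [hJ]
  intro m hm
  refine (hJ f).1 hf m ?_
  rw [mem_support_iff, coeff_homogeneousComponent] at hm
  rw [mem_support_iff]
  split_ifs at hm
  · exact hm
  · exact absurd rfl hm

/-- Every minimal monomial generator of a monomial ideal has the degree of a basis element of
`F₀`, for every graded free resolution. -/
theorem MinimalGradedFreeResolution.exists_deg_zero_eq {J : Ideal (MvPolynomial V K)}
    (hJ : IsMonomialIdeal J) (F : MinimalGradedFreeResolution J) {u : V →₀ ℕ}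
    (hu : u ∈ minimalMonomialGenerators J) : ∃ b, F.deg 0 b = u.degree := by
  classical
  have huJ : monomial u (1 : K) ∈ LinearMap.range F.aug := by
    rw [F.range_aug]
    exact hu.1
  obtain ⟨w, hw⟩ := huJ
  have hw' : ∑ b, w b * F.aug (Pi.single b 1) = monomial u 1 := by
    rw [← hw]
    conv_rhs => rw [pi_eq_sum_univ' w, map_sum]
    exact Finset.sum_congr rfl fun b _ => (F.aug.map_smul _ _).symm
  have hcoeff := congrArg (coeff u) hw'
  rw [coeff_sum, coeff_monomial, if_pos rfl] at hcoeff
  -- Some product in the expansion contributes to `u`, so a monomial of the image of a basis element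
  -- divides `u`. It lies in `J`, hence equals `u` by minimality.
  obtain ⟨b, -, hb⟩ := Finset.exists_ne_zero_of_sum_ne_zero (hcoeff.trans_ne one_ne_zero)
  rw [coeff_mul] at hb
  obtain ⟨⟨m, m'⟩, hmm, hne⟩ := Finset.exists_ne_zero_of_sum_ne_zero hb
  rw [Finset.HasAntidiagonal.mem_antidiagonal] at hmm
  have hm' : coeff m' (F.aug (Pi.single b 1)) ≠ 0 := right_ne_zero_of_mul hne
  have hmem : F.aug (Pi.single b 1) ∈ J := by
    have := LinearMap.mem_range_self F.aug (Pi.single b 1)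
    rwa [F.range_aug] at this
  have hm'J := (hJ _).1 hmem m' (mem_support_iff.2 hm')
  have hle : m' ≤ u := hmm ▸ le_add_self
  obtain rfl : u = m' := le_antisymm (hu.2 hm'J hle) hle
  refine ⟨b, ?_⟩
  have := F.aug_homogeneous b hm'
  rw [← this, Finsupp.degree_eq_weight_one]
  rfl

/-- The generator gives `β_{0,j} ≠ 0` for its degree `j`. Existence of a resolution matters, since
`gradedBetti` is 0 by default. -/
theorem le_regularity_of_mem_minimalMonomialGenerators [Finite V]
    {J : Ideal (MvPolynomial V K)} (hJ : IsMonomialIdeal J) {u : V →₀ ℕ}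
    (hu : u ∈ minimalMonomialGenerators J) : ((u.degree : ℝ) : EReal) ≤ regularity J := by
  have hne : Nonempty (MinimalGradedFreeResolution J) :=
    nonempty_minimalGradedFreeResolution fun k f hf => hJ.homogeneousComponent_mem k hf
  refine le_sSup ⟨0, u.degree, ?_, by simp⟩
  rw [gradedBetti, dif_pos hne]
  obtain ⟨b, hb⟩ := hne.some.exists_deg_zero_eq hJ hu
  have : Nonempty {b // hne.some.deg 0 b = u.degree} := ⟨⟨b, hb⟩⟩
  exact Nat.card_pos.ne'

theorem IsCameronWalker.exists_mem_minimalMonomialGenerators [Finite V] {G : SimpleGraph V}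
    (hG : IsCameronWalker G) {s : ℕ} (hs₁ : inducedMatchingNumber G ≤ s)
    (hs₂ : (s : ℕ∞) ≤ (edgeIdeal K G).height) :
    ∃ u ∈ minimalMonomialGenerators (squarefreeSymbolicPower (edgeIdeal K G) s),
      u.degree = s + inducedMatchingNumber G := by
  classical
  obtain ⟨A, hcard, hcov, hcrit⟩ := hG.exists_critical_finset hs₁ fun C hC => by
    exact_mod_cast hs₂.trans (height_edgeIdeal_le_card hC)
  let u : V →₀ ℕ := Finsupp.indicator A fun _ _ => 1
  have hu : ∀ v, u v = if v ∈ A then 1 else 0 := fun v => by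
    simp [u, Finsupp.indicator_apply]
  have hu1 : ∀ v, u v ≤ 1 := fun v => by rw [hu]; split_ifs <;> simp
  refine ⟨u, ⟨?_, fun m hm hmu v => ?_⟩, ?_⟩
  · refine (monomial_mem_squarefreePart_iff hu1).2
      (monomial_mem_symbolicPower_edgeIdeal fun C hC => ?_)
    simpa [hu, Finset.inter_comm] using hcov C hC
  · by_contra! hlt
    have hvA : v ∈ A := by
      by_contra h
      simp [hu, h] at hlt
    obtain ⟨C, hC, hCs⟩ := hcrit v hvA
    have hle := monomial_mem_symbolicPower_edgeIdeal_iff.1 (squarefreePart_le _ hm) C hC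
    -- A proper divisor of `u` loses some `v ∈ A` entirely, so it divides the monomial of `A \ {v}`,
    -- whose sum over the critical cover is below `s`.
    have : ∑ w ∈ C, m w ≤ ∑ w ∈ C, if w ∈ A.erase v then 1 else 0 := by
      refine Finset.sum_le_sum fun w _ => ?_
      have h1 := hmu w
      have h2 := hu1 v
      rw [hu] at h1
      by_cases hwv : w = v
      · subst hwv
        simp only [Finset.mem_erase, ne_eq, not_true_eq_false, false_and, if_false]
        omega
      · simpa [hwv] using h1
    rw [Finset.sum_ite_mem, Finset.sum_const, smul_eq_mul, mul_one, Finset.inter_comm] at this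
    omega
  · have := Fintype.ofFinite V
    rw [Finsupp.degree_eq_sum, ← hcard]
    simp [hu]

end SquarefreePart

end SymbPow

theorem mainTheorem6 {V : Type*} [Finite V] {K : Type*} [Field K] (G : SimpleGraph V)
    (hG : SymbPow.IsCameronWalker G) (s : ℕ)
    (hs₁ : SymbPow.inducedMatchingNumber G ≤ s)
    (hs₂ : (s : ℕ∞) ≤ (SymbPow.edgeIdeal K G).height) :
    (∃ u ∈ SymbPow.minimalMonomialGenerators
        (SymbPow.squarefreeSymbolicPower (SymbPow.edgeIdeal K G) s),
      u.degree = s + SymbPow.inducedMatchingNumber G) ∧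
    (((s + SymbPow.inducedMatchingNumber G : ℕ) : ℝ) : EReal) ≤
      SymbPow.regularity (SymbPow.squarefreeSymbolicPower (SymbPow.edgeIdeal K G) s) := by
  obtain ⟨u, hu, hdeg⟩ := hG.exists_mem_minimalMonomialGenerators hs₁ hs₂
  refine ⟨⟨u, hu, hdeg⟩, ?_⟩
  rw [← hdeg]
  exact SymbPow.le_regularity_of_mem_minimalMonomialGenerators
    (SymbPow.isMonomialIdeal_squarefreePart _) hu
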